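/- Let $k$ be a field of characteristic zero and let $\mathfrak g$ be a (possibly infinite-dimensional) Lie algebra over $k$, with symmetric algebra $S=S\mathfrak g=\bigoplus_{n\ge 0}S^n$ and universal enveloping algebra $U=U\mathfrak g$. Let $e:S\to U$ be the symmetrization map, the $k$-linear map with $$e(g_1\cdots g_n)=\frac1{n!}\sum_{\sigma\in\mathfrak S_n}g_{\sigma(1)}\cdots g_{\sigma(n)}\qquad(n\ge 0,\ g_1,\dots,g_n\in\mathfrak g).$$ Then $e$ is bijective (Poincaré–Birkhoff–Witt). Let $B:S\times S\to S$ be the bilinear map $B(x,y)=e^{-1}(e(x)e(y))$, and for $p\ge 0$ let $B_p:S\times S\to S$ be its homogeneous component of degree $-p$, that is, the bilinear map that sends $(x,y)\in S^n\times S^m$ to the component of $B(x,y)$ in $S^{n+m-p}$ (to $0$ if $n+m<p$). A $k$-linear endomorphism $F$ of a commutative $k$-algebra $A$ is called a differential operator of order $\le p$ if $$\sum_{I\subseteq\{0,1,\dots,p\}}(-1)^{\#I}\Big(\prod_{i\notin I}a_i\Big)F\Big(\Big(\prod_{i\in I}a_i\Big)b\Big)=0\qquad\text{for all }a_0,\dots,a_p,b\in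 A,$$ and a bilinear map $A\times A\to A$ is called a bidifferential operator of order $\le p$ if it is a differential operator of order $\le p$ in each of its arguments when the other one is fixed. Theorem. For every $p\ge 1$ and every $a\in S$, the maps $B_p(a,\cdot)$ and $B_p(\cdot,a)$ from $S$ to $S$ are differential operators of order $\le p$. Hence $B_p$ is a bidifferential operator of order $\le p$. -/

import Mathlib

noncomputable section

namespace PBW

open scoped DirectSum

/-! ### The grading of the symmetric algebra -/

section Grading

variable (k V : Type*) [CommRing k] [AddCommGroup V] [Module k V]

/-- The homogeneous component `Sⁿ V` of the symmetric algebra: the span of the products of `n`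
elements of `V`. -/
def symPow (n : ℕ) : Submodule k (SymmetricAlgebra k V) :=
  LinearMap.range (SymmetricAlgebra.ι k V) ^ n

instance : SetLike.GradedMonoid (symPow k V) :=
  inferInstanceAs (SetLike.GradedMonoid (LinearMap.range (SymmetricAlgebra.ι k V) ^ ·))

theorem ι_mem_symPow (v : V) : SymmetricAlgebra.ι k V v ∈ symPow k V 1 := by
  simp [symPow]

/-- The inclusion of `V` in degree one of the direct sum of the `Sⁿ V`. -/
def gradedι : V →ₗ[k] ⨁ n, symPow k V n :=
  DirectSum.lof k ℕ (fun n => symPow k V n) 1 ∘ₗ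
    (SymmetricAlgebra.ι k V).codRestrict _ (ι_mem_symPow k V)

theorem gradedι_apply (v : V) :
    gradedι k V v = DirectSum.of (fun n => symPow k V n) 1
      ⟨SymmetricAlgebra.ι k V v, ι_mem_symPow k V v⟩ := rfl

/-- The symmetric algebra is graded, `S V = ⨁ n, Sⁿ V`. -/
instance symGraded : GradedAlgebra (symPow k V) :=
  GradedAlgebra.ofAlgHom _ (SymmetricAlgebra.lift (gradedι k V))
    (by
      apply SymmetricAlgebra.algHom_ext
      ext v
      simp [gradedι_apply])
    (fun n x => by
      obtain ⟨x, hx⟩ := x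
      change SymmetricAlgebra.lift (gradedι k V) x = _
      unfold symPow at hx
      induction hx using Submodule.pow_induction_on_left' with
      | algebraMap r =>
        rw [AlgHom.commutes, DirectSum.algebraMap_apply]; rfl
      | add x y i hx hy ihx ihy =>
        rw [map_add, ihx, ihy, ← map_add]
        rfl
      | mem_mul m hm i x hx ih =>
        obtain ⟨v, rfl⟩ := hm
        rw [map_mul, ih, SymmetricAlgebra.lift_ι_apply, gradedι_apply, DirectSum.of_mul_of]
        exact DirectSum.of_eq_of_gradedMonoid_eq (Sigma.subtype_ext (add_comm _ _) rfl))

end Grading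

/-! ### The symmetrization map -/

section Symmetrization

attribute [local instance] LieRing.ofAssociativeRing

variable (k g : Type*) [Field k] [LieRing g] [LieAlgebra k g]

/-- `(x₁, …, xₙ) ↦ (1 / n!) ∑_σ x_{σ(1)} ⋯ x_{σ(n)}`, with values in the enveloping algebra. -/
def symMultilinear (n : ℕ) :
    MultilinearMap k (fun _ : Fin n => g) (UniversalEnvelopingAlgebra k g) :=
  (n.factorial : k)⁻¹ • ∑ σ : Equiv.Perm (Fin n),
    ((MultilinearMap.mkPiAlgebraFin k n (UniversalEnvelopingAlgebra k g)).compLinearMap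
      (fun _ => LieHom.toLinearMap (UniversalEnvelopingAlgebra.ι k))).domDomCongr σ

theorem symMultilinear_apply (n : ℕ) (x : Fin n → g) :
    symMultilinear k g n x = (n.factorial : k)⁻¹ • ∑ σ : Equiv.Perm (Fin n),
      (List.ofFn fun i => UniversalEnvelopingAlgebra.ι k (x (σ i))).prod := by
  simp [symMultilinear]

theorem symMultilinear_perm (n : ℕ) (x : Fin n → g) (τ : Equiv.Perm (Fin n)) :
    symMultilinear k g n (x ∘ τ) = symMultilinear k g n x := by
  simp only [symMultilinear_apply, Function.comp_apply]
  congr 1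
  exact Fintype.sum_equiv (Equiv.mulLeft τ) _ _ (fun σ => by simp)

/-- The symmetrization map on the tensor algebra. -/
def symTensor : TensorAlgebra k g →ₗ[k] UniversalEnvelopingAlgebra k g :=
  DirectSum.toModule k ℕ _ (fun n => PiTensorProduct.lift (symMultilinear k g n)) ∘ₗ
    (TensorAlgebra.equivDirectSum (R := k) (M := g)).toLinearMap

theorem symTensor_tprod (n : ℕ) (x : Fin n → g) :
    symTensor k g (TensorAlgebra.tprod k g n x) = symMultilinear k g n x := by
  have h : (TensorAlgebra.equivDirectSum (R := k) (M := g)) (TensorAlgebra.tprod k g n x) =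
      DirectSum.lof k ℕ (fun n => TensorPower k n g) n (PiTensorProduct.tprod k x) :=
    TensorAlgebra.toDirectSum_tensorPower_tprod x
  simp only [symTensor, LinearMap.comp_apply, AlgEquiv.toLinearMap_apply, h,
    DirectSum.toModule_lof]
  simp

/-- The tensor algebra is spanned by the products of lists of elements of `g`. -/
theorem tensor_span :
    Submodule.span k (Set.range fun l : List g => (l.map (TensorAlgebra.ι k)).prod) = ⊤ := by
  rw [eq_top_iff]
  rintro t -
  induction t using TensorAlgebra.induction with
  | algebraMap r =>
    rw [Algebra.algebraMap_eq_smul_one]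
    exact Submodule.smul_mem _ _ (Submodule.subset_span ⟨[], by simp⟩)
  | ι x => exact Submodule.subset_span ⟨[x], by simp⟩
  | add a b ha hb => exact Submodule.add_mem _ ha hb
  | mul a b ha hb =>
    have := Submodule.mul_mem_mul ha hb
    rw [Submodule.span_mul_span] at this
    refine Submodule.span_mono ?_ this
    rintro _ ⟨_, ⟨l, rfl⟩, _, ⟨m, rfl⟩, rfl⟩
    exact ⟨l ++ m, by simp⟩

theorem symTensor_swap_list (l m : List g) (x y : g) :
    symTensor k g ((l.map (TensorAlgebra.ι k)).prod * (TensorAlgebra.ι k x * TensorAlgebra.ι k y) *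
        (m.map (TensorAlgebra.ι k)).prod) =
      symTensor k g ((l.map (TensorAlgebra.ι k)).prod *
        (TensorAlgebra.ι k y * TensorAlgebra.ι k x) * (m.map (TensorAlgebra.ι k)).prod) := by
  set w : List g := l ++ x :: y :: m with hw
  have hl : l.length + 1 < w.length := by simp [hw]
  let τ : Equiv.Perm (Fin w.length) := Equiv.swap ⟨l.length, by omega⟩ ⟨l.length + 1, hl⟩
  have h₁ : (l.map (TensorAlgebra.ι k)).prod * (TensorAlgebra.ι k x * TensorAlgebra.ι k y) *
      (m.map (TensorAlgebra.ι k)).prod = TensorAlgebra.tprod k g _ w.get := by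
    have : List.ofFn (fun i => TensorAlgebra.ι k (w.get i)) = w.map (TensorAlgebra.ι k) := by
      apply List.ext_get <;> simp
    rw [TensorAlgebra.tprod_apply, this]
    simp [hw, mul_assoc]
  have h₂ : (l.map (TensorAlgebra.ι k)).prod * (TensorAlgebra.ι k y * TensorAlgebra.ι k x) *
      (m.map (TensorAlgebra.ι k)).prod = TensorAlgebra.tprod k g _ (w.get ∘ τ) := by
    have : List.ofFn (w.get ∘ τ) = l ++ y :: x :: m := by
      apply List.ext_getElem
      · simp [hw, add_assoc]
      · intro i hi hi'
        simp only [List.getElem_ofFn, Function.comp_apply, τ, Equiv.swap_apply_def]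
        grind
    have : List.ofFn (fun i => TensorAlgebra.ι k ((w.get ∘ τ) i)) =
        (l ++ y :: x :: m).map (TensorAlgebra.ι k) := by
      rw [← this, List.map_ofFn]
      rfl
    rw [TensorAlgebra.tprod_apply, this]
    simp [mul_assoc]
  rw [h₁, h₂, symTensor_tprod, symTensor_tprod, symMultilinear_perm]

theorem symTensor_swap (s t : TensorAlgebra k g) (x y : g) :
    symTensor k g (s * (TensorAlgebra.ι k x * TensorAlgebra.ι k y) * t) =
      symTensor k g (s * (TensorAlgebra.ι k y * TensorAlgebra.ι k x) * t) := by
  have hs : s ∈ Submodule.span k (Set.range fun l : List g => (l.map (TensorAlgebra.ι k)).prod) :=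
    tensor_span k g ▸ Submodule.mem_top
  have ht : t ∈ Submodule.span k (Set.range fun l : List g => (l.map (TensorAlgebra.ι k)).prod) :=
    tensor_span k g ▸ Submodule.mem_top
  induction hs using Submodule.span_induction with
  | zero => simp
  | add a b _ _ ha hb => simp only [add_mul, map_add, ha, hb]
  | smul r a _ ha => simp only [smul_mul_assoc, map_smul, ha]
  | mem a ha =>
    obtain ⟨l, rfl⟩ := ha
    induction ht using Submodule.span_induction with
    | zero => simp
    | add a b _ _ ha hb => simp only [mul_add, map_add, ha, hb]
    | smul r a _ ha => simp only [mul_smul_comm, map_smul, ha]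
    | mem a ha =>
      obtain ⟨m, rfl⟩ := ha
      exact symTensor_swap_list k g l m x y

/-- The largest ring congruence through which `symTensor` factors. -/
def symCon : RingCon (TensorAlgebra k g) where
  r a b := ∀ s t, symTensor k g (s * a * t) = symTensor k g (s * b * t)
  iseqv := ⟨fun _ _ _ => rfl, fun h s t => (h s t).symm, fun h h' s t => (h s t).trans (h' s t)⟩
  add' h h' s t := by simp only [mul_add, add_mul, map_add, h s t, h' s t]
  mul' {a b c d} h h' s t := by
    rw [show s * (a * c) * t = s * a * (c * t) by simp only [mul_assoc], h,
      show s * b * (c * t) = (s * b) * c * t by simp only [mul_assoc], h']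
    simp only [mul_assoc]

theorem symRingCon_le : TensorAlgebra.symRingCon k g ≤ symCon k g := by
  refine RingCon.ringConGen_le.2 fun a b h => ?_
  cases h with
  | mul_comm x y => exact fun s t => symTensor_swap k g s t x y

theorem symTensor_eq {a b : TensorAlgebra k g} (h : TensorAlgebra.symRingCon k g a b) :
    symTensor k g a = symTensor k g b := by
  simpa using symRingCon_le k g h 1 1

/-- The symmetrization map `e : S g → U g`; see `symmetrization_prod` for its values on
monomials. -/
def symmetrization : SymmetricAlgebra k g →ₗ[k] UniversalEnvelopingAlgebra k g where
  toFun := Quotient.lift (symTensor k g) (fun _ _ h => symTensor_eq k g h)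
  map_add' a b := by
    obtain ⟨a, rfl⟩ := SymmetricAlgebra.algHom_surjective k g a
    obtain ⟨b, rfl⟩ := SymmetricAlgebra.algHom_surjective k g b
    rw [← map_add]
    exact map_add (symTensor k g) a b
  map_smul' r a := by
    obtain ⟨a, rfl⟩ := SymmetricAlgebra.algHom_surjective k g a
    rw [← map_smul]
    exact map_smul (symTensor k g) r a

/-- `e(x₁ ⋯ xₙ) = (1 / n!) ∑_σ x_{σ(1)} ⋯ x_{σ(n)}`. -/
theorem symmetrization_prod (n : ℕ) (x : Fin n → g) :
    symmetrization k g (∏ i, SymmetricAlgebra.ι k g (x i)) =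
      (n.factorial : k)⁻¹ • ∑ σ : Equiv.Perm (Fin n),
        (List.ofFn fun i => UniversalEnvelopingAlgebra.ι k (x (σ i))).prod := by
  have h : ∏ i, SymmetricAlgebra.ι k g (x i) =
      SymmetricAlgebra.algHom k g (TensorAlgebra.tprod k g n x) := by
    rw [TensorAlgebra.tprod_apply, map_list_prod, List.map_ofFn, List.prod_ofFn]
    rfl
  rw [h, ← symMultilinear_apply, ← symTensor_tprod]
  rfl

/-- The inverse `e⁻¹ : U g → S g` of the symmetrization map (and `0` if `e` were not bijective). -/
def symmetrizationInv : UniversalEnvelopingAlgebra k g →ₗ[k] SymmetricAlgebra k g :=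
  open Classical in
  if h : Function.Bijective (symmetrization k g) then
    (LinearEquiv.ofBijective (symmetrization k g) h).symm.toLinearMap
  else 0

/-- The product `B(x, y) = e⁻¹(e(x) e(y))` on the symmetric algebra. -/
def starProduct :
    SymmetricAlgebra k g →ₗ[k] SymmetricAlgebra k g →ₗ[k] SymmetricAlgebra k g :=
  ((LinearMap.mul k (UniversalEnvelopingAlgebra k g)).compl₁₂
    (symmetrization k g) (symmetrization k g)).compr₂ (symmetrizationInv k g)

theorem starProduct_apply (x y : SymmetricAlgebra k g) :
    starProduct k g x y =
      symmetrizationInv k g (symmetrization k g x * symmetrization k g y) := rfl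

end Symmetrization

/-! ### Homogeneous components of a bilinear map -/

section Components

variable {k V : Type*} [CommRing k] [AddCommGroup V] [Module k V]

/-- The homogeneous component of degree `-p` of a bilinear map `B` on `S V`: the bilinear map that
sends `(x, y) ∈ Sⁿ V × Sᵐ V` to the component of degree `n + m - p` of `B(x, y)`, and to `0` if
`n + m < p`; see `component_apply`. -/
def component
    (B : SymmetricAlgebra k V →ₗ[k] SymmetricAlgebra k V →ₗ[k] SymmetricAlgebra k V) (p : ℕ) :
    SymmetricAlgebra k V →ₗ[k] SymmetricAlgebra k V →ₗ[k] SymmetricAlgebra k V :=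
  DirectSum.toModule k ℕ _ (fun n =>
    (DirectSum.toModule k ℕ _ (fun m =>
      (if p ≤ n + m then
        (B.compr₂ (GradedAlgebra.proj (symPow k V) (n + m - p))).domRestrict₁₂
          (symPow k V n) (symPow k V m)
      else 0).flip) ∘ₗ
      (DirectSum.decomposeLinearEquiv (symPow k V)).toLinearMap).flip) ∘ₗ
    (DirectSum.decomposeLinearEquiv (symPow k V)).toLinearMap

theorem component_apply
    (B : SymmetricAlgebra k V →ₗ[k] SymmetricAlgebra k V →ₗ[k] SymmetricAlgebra k V) (p : ℕ)
    {n m : ℕ} {x y : SymmetricAlgebra k V} (hx : x ∈ symPow k V n) (hy : y ∈ symPow k V m) :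
    component B p x y =
      if p ≤ n + m then GradedAlgebra.proj (symPow k V) (n + m - p) (B x y) else 0 := by
  lift x to symPow k V n using hx
  lift y to symPow k V m using hy
  simp only [component, LinearMap.comp_apply, LinearEquiv.coe_coe,
    DirectSum.decomposeLinearEquiv_apply_coe, DirectSum.toModule_lof, LinearMap.flip_apply]
  split_ifs
  · rfl
  · simp

end Components

/-- The component `B_p` of degree `-p` of the product `B(x, y) = e⁻¹(e(x) e(y))` on `S g`. -/
def starComponent (k g : Type*) [Field k] [LieRing g] [LieAlgebra k g] (p : ℕ) :
    SymmetricAlgebra k g →ₗ[k] SymmetricAlgebra k g →ₗ[k] SymmetricAlgebra k g :=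
  component (starProduct k g) p

/-! ### Differential operators -/

section DifferentialOperators

variable {k A : Type*} [CommRing k] [CommRing A] [Algebra k A]

/-- A `k`-linear endomorphism `F` of a commutative algebra is a differential operator of order
`≤ p` if its iterated commutator with the multiplications by any `p + 1` elements vanishes, that
is `∑_{S ⊆ {0, …, p}} (-1)^{#S} a_{Sᶜ} F(a_S b) = 0`. -/
def IsDifferentialOperator (p : ℕ) (F : A →ₗ[k] A) : Prop :=
  ∀ (a : Fin (p + 1) → A) (b : A),
    ∑ S : Finset (Fin (p + 1)), (-1) ^ S.card * (∏ i ∈ Sᶜ, a i) * F ((∏ i ∈ S, a i) * b) = 0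

/-- A bilinear map is a bidifferential operator of order `≤ p` if it is a differential operator of
order `≤ p` in each argument when the other one is fixed. -/
def IsBidifferentialOperator (p : ℕ) (B : A →ₗ[k] A →ₗ[k] A) : Prop :=
  (∀ a, IsDifferentialOperator p (B a)) ∧ ∀ a, IsDifferentialOperator p (B.flip a)

end DifferentialOperators

end PBW

end

/-! The idea is to write multiplication by `x` in the enveloping algebra, transported to the
symmetric algebra, as a formal vector field in exponential coordinates. A linear map `C : S → V`
defines the operator `convOp C`, given formally by `e^y ↦ C(e^y) e^y`. Left multiplication by `x`
should be the case `C(e^y) = φ(ad_y) x` with `φ(t) = t/(e^t - 1)`, so that `C(y^n) = B_n ad_y^n x`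
with Bernoulli numbers `B_n`.

This guess is verified without assuming PBW. Operators `convOp C` are closed under commutators
(`convOp_commutator`), and the functional equation of `φ` (`bernoulli_euler`) makes `x ↦ convOp
(bernoulliEval k x)` a Lie algebra representation `leftRep`. Extending it to the enveloping algebra
and acting on `1` gives a left inverse of symmetrization, because `ad_y y = 0` forces `y · y^n =
y^(n+1)`. Symmetrization is surjective by induction on the length of words, so it is bijective and
intertwines `leftRep` with left multiplication. Right multiplication differs only by replacing `B_1
= -1/2` with `1/2`.

By polarization it suffices to treat `a = x^n`, for which `B(a, ·)` is the `n`-th power of `leftRep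
k g x`. The degree `p` part of `C` gives a summand of `convOp C` that shifts degree by `1 - p` and
has order at most `p`. Under composition both losses of degree and orders add, so the part of the
`n`-th power that shifts degree by `n - p` has order at most `p`; this part is `B_p(a, ·)`. -/

noncomputable section

namespace PBW

/-! ### Differential operators via iterated commutators -/

section DifferentialOperators

variable {k A : Type*} [CommRing k] [CommRing A] [Algebra k A]

/-- The commutator of a linear endomorphism with the multiplication by `a`. -/
def mulCommutator (a : A) : (A →ₗ[k] A) →ₗ[k] (A →ₗ[k] A) where
  toFun F := F ∘ₗ LinearMap.mulLeft k a - LinearMap.mulLeft k a ∘ₗ F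
  map_add' F G := by ext; simp; ring
  map_smul' r F := by ext; simp [smul_sub]

@[simp]
theorem mulCommutator_apply (a : A) (F : A →ₗ[k] A) (b : A) :
    mulCommutator a F b = F (a * b) - a * F b := rfl

variable (k A) in
/-- The space of the linear endomorphisms whose `q`-fold commutators with multiplications vanish,
that is, of the differential operators of order `< q`. -/
def diffOp : ℕ → Submodule k (A →ₗ[k] A)
  | 0 => ⊥
  | q + 1 => ⨅ a : A, (diffOp q).comap (mulCommutator a)

theorem mem_diffOp_zero {F : A →ₗ[k] A} : F ∈ diffOp k A 0 ↔ F = 0 := Iff.rfl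

theorem mem_diffOp_succ {q : ℕ} {F : A →ₗ[k] A} :
    F ∈ diffOp k A (q + 1) ↔ ∀ a, mulCommutator a F ∈ diffOp k A q := by
  simp [diffOp]

theorem diffOp_le_succ (q : ℕ) : diffOp k A q ≤ diffOp k A (q + 1) := by
  induction q with
  | zero =>
    intro F hF
    rw [mem_diffOp_zero] at hF
    simp [hF]
  | succ q ih =>
    intro F hF
    rw [mem_diffOp_succ] at hF ⊢
    exact fun a => ih (hF a)

theorem diffOp_mono : Monotone (diffOp k A) := monotone_nat_of_le_succ diffOp_le_succ

theorem mulLeft_comp_mem_diffOp {q : ℕ} {F : A →ₗ[k] A} (hF : F ∈ diffOp k A q) (c : A) :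
    LinearMap.mulLeft k c ∘ₗ F ∈ diffOp k A q := by
  induction q generalizing F with
  | zero =>
    rw [mem_diffOp_zero] at hF ⊢
    simp [hF]
  | succ q ih =>
    rw [mem_diffOp_succ] at hF ⊢
    intro a
    convert ih (hF a) using 1
    ext b
    simp
    ring

theorem comp_mulLeft_mem_diffOp {q : ℕ} {F : A →ₗ[k] A} (hF : F ∈ diffOp k A q) (c : A) :
    F ∘ₗ LinearMap.mulLeft k c ∈ diffOp k A q := by
  induction q generalizing F with
  | zero =>
    rw [mem_diffOp_zero] at hF ⊢
    simp [hF]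
  | succ q ih =>
    rw [mem_diffOp_succ] at hF ⊢
    intro a
    convert ih (hF a) using 1
    ext b
    simp [mul_left_comm]

/-- It is enough to test commutators with algebra generators. -/
theorem mem_diffOp_succ_of_adjoin {s : Set A} (hs : Algebra.adjoin k s = ⊤) {q : ℕ}
    {F : A →ₗ[k] A} (hF : ∀ a ∈ s, mulCommutator a F ∈ diffOp k A q) :
    F ∈ diffOp k A (q + 1) := by
  rw [mem_diffOp_succ]
  intro a
  have ha : a ∈ Algebra.adjoin k s := hs ▸ Algebra.mem_top
  induction ha using Algebra.adjoin_induction with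
  | mem a ha => exact hF a ha
  | algebraMap r =>
    convert (diffOp k A q).zero_mem
    ext b
    simp [← Algebra.smul_def]
  | add a b _ _ ha hb =>
    convert add_mem ha hb using 1
    ext c
    simp [add_mul]
    ring
  | mul a b _ _ ha hb =>
    convert add_mem (comp_mulLeft_mem_diffOp ha b) (mulLeft_comp_mem_diffOp hb a) using 1
    ext c
    simp [mul_assoc]
    ring

/-- Commutation with `a` is a derivation for composition, so each of the two resulting terms has one
order less. In order zero the commutator vanishes, and its term with it. -/
theorem comp_mem_diffOp {p q : ℕ} {F G : A →ₗ[k] A} (hF : F ∈ diffOp k A (p + 1))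
    (hG : G ∈ diffOp k A (q + 1)) : F ∘ₗ G ∈ diffOp k A (p + q + 1) := by
  induction h : p + q using Nat.strong_induction_on generalizing p q F G with
  | _ n ih =>
    rw [mem_diffOp_succ]
    intro a
    have e : mulCommutator a (F ∘ₗ G) =
        F ∘ₗ mulCommutator a G + mulCommutator a F ∘ₗ G := by
      ext b
      simp
    rw [e]
    refine add_mem ?_ ?_
    · have hGa := mem_diffOp_succ.1 hG a
      cases q with
      | zero =>
        rw [mem_diffOp_zero.1 hGa, LinearMap.comp_zero]
        exact zero_mem _
      | succ q =>
        have := ih (p + q) (by omega) hF hGa rfl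
        exact diffOp_mono (by omega) this
    · have hFa := mem_diffOp_succ.1 hF a
      cases p with
      | zero =>
        rw [mem_diffOp_zero.1 hFa, LinearMap.zero_comp]
        exact zero_mem _
      | succ p =>
        have := ih (p + q) (by omega) hFa hG rfl
        exact diffOp_mono (by omega) this

/-- Splitting the subsets of `insert j s` by whether they contain `j` turns the sum into minus the
sum over `s` for the commutator of `F` with `a j`. -/
theorem sum_powerset_eq_zero_of_mem_diffOp {ι : Type*} [DecidableEq ι] (s : Finset ι) (a : ι → A)
    {F : A →ₗ[k] A} (hF : F ∈ diffOp k A s.card) (b : A) :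
    ∑ S ∈ s.powerset, (-1) ^ S.card * (∏ i ∈ s \ S, a i) * F ((∏ i ∈ S, a i) * b) = 0 := by
  induction s using Finset.induction_on generalizing F with
  | empty => simp [mem_diffOp_zero.1 (by simpa using hF)]
  | insert j s hj ih =>
    rw [Finset.card_insert_of_notMem hj, mem_diffOp_succ] at hF
    rw [Finset.sum_powerset_insert hj, ← Finset.sum_add_distrib, ← neg_eq_zero, ← ih (hF (a j)),
      ← Finset.sum_neg_distrib]
    refine Finset.sum_congr rfl fun S hS => ?_
    have hS' := Finset.mem_powerset.1 hS
    have hjS : j ∉ S := fun h => hj (hS' h)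
    rw [Finset.card_insert_of_notMem hjS, Finset.prod_insert hjS,
      Finset.insert_sdiff_insert, Finset.insert_sdiff_of_notMem _ hjS,
      Finset.prod_insert (by simp [hj]), Finset.sdiff_insert_of_notMem hj]
    simp [mul_assoc]
    ring

theorem isDifferentialOperator_of_mem_diffOp {p : ℕ} {F : A →ₗ[k] A}
    (hF : F ∈ diffOp k A (p + 1)) : IsDifferentialOperator p F := fun a b => by
  have := sum_powerset_eq_zero_of_mem_diffOp (Finset.univ : Finset (Fin (p + 1))) a
    (by simpa using hF) b
  simpa [Finset.compl_eq_univ_sdiff] using this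

end DifferentialOperators

end PBW

end

noncomputable section

namespace PBW

open scoped DirectSum TensorProduct

/-! ### Polarization and coderivations of the symmetric algebra -/

section SymmetricAlgebra

variable {k V : Type*} [Field k] [AddCommGroup V] [Module k V]

local notation "S" => SymmetricAlgebra k V
local notation "ιS" => SymmetricAlgebra.ι k V

variable (k V) in
theorem adjoin_range_ι : Algebra.adjoin k (Set.range ιS) = ⊤ := by
  rw [eq_top_iff]
  rintro s -
  induction s using SymmetricAlgebra.induction with
  | algebraMap r => exact Subalgebra.algebraMap_mem _ r
  | ι x => exact Algebra.subset_adjoin ⟨x, rfl⟩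
  | mul a b ha hb => exact mul_mem ha hb
  | add a b ha hb => exact add_mem ha hb

/-- Induction on monomials. -/
theorem symmetricAlgebra_induction {P : S → Prop} (one : P 1) (smul : ∀ (r : k) s, P s → P (r • s))
    (add : ∀ s t, P s → P t → P (s + t)) (ι_mul : ∀ v s, P s → P (ιS v * s)) (s : S) : P s := by
  suffices h : ∀ t, P t → P (s * t) by simpa using h 1 one
  induction s using SymmetricAlgebra.induction with
  | algebraMap r =>
    intro t ht
    rw [← Algebra.smul_def]
    exact smul r t ht
  | ι x => exact fun t ht => ι_mul x t ht
  | mul a b ha hb =>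
    intro t ht
    rw [mul_assoc]
    exact ha _ (hb _ ht)
  | add a b ha hb =>
    intro t ht
    rw [add_mul]
    exact add _ _ (ha t ht) (hb t ht)

/-- A polynomial with vector coefficients that vanishes at all points of an infinite field is
zero. -/
theorem eq_zero_of_forall_sum_pow_smul_eq_zero [Infinite k] {M : Type*} [AddCommGroup M]
    [Module k M] {n : ℕ} {m : ℕ → M} (h : ∀ t : k, ∑ i ∈ Finset.range n, t ^ i • m i = 0) {i : ℕ}
    (hi : i < n) : m i = 0 := by
  rw [← Module.forall_dual_apply_eq_zero_iff k]
  intro f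
  have hp : ∑ j ∈ Finset.range n, Polynomial.C (f (m j)) * Polynomial.X ^ j = 0 := by
    refine Polynomial.funext fun t => ?_
    have := congrArg f (h t)
    simp only [map_sum, map_smul, smul_eq_mul, map_zero] at this
    rw [Polynomial.eval_zero, ← this, Polynomial.eval_finsetSum]
    exact Finset.sum_congr rfl fun j _ => by
      rw [Polynomial.eval_mul, Polynomial.eval_C, Polynomial.eval_pow, Polynomial.eval_X, mul_comm]
  have := congrArg (fun p => Polynomial.coeff p i) hp
  simpa [Polynomial.finsetSum_coeff, Polynomial.coeff_C_mul, Polynomial.coeff_X_pow, hi] using this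

theorem mem_of_forall_sum_pow_smul_mem [Infinite k] {M : Type*} [AddCommGroup M]
    [Module k M] (N : Submodule k M) {n : ℕ} {m : ℕ → M}
    (h : ∀ t : k, ∑ i ∈ Finset.range n, t ^ i • m i ∈ N) {i : ℕ} (hi : i < n) : m i ∈ N := by
  rw [← Submodule.Quotient.mk_eq_zero]
  refine eq_zero_of_forall_sum_pow_smul_eq_zero (k := k) (n := n)
    (m := fun i => (Submodule.Quotient.mk (m i) : M ⧸ N)) (fun t => ?_) hi
  have := (Submodule.Quotient.mk_eq_zero N).2 (h t)
  rw [← Submodule.mkQ_apply] at this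
  simpa using this

variable (k V) in
/-- Polarization: the powers of elements of `V` span the symmetric algebra. -/
theorem span_pow [CharZero k] : Submodule.span k (Set.range fun x : ℕ × V => ιS x.2 ^ x.1) = ⊤ := by
  rw [eq_top_iff]
  rintro s -
  induction s using symmetricAlgebra_induction with
  | one => exact Submodule.subset_span ⟨(0, 0), by simp⟩
  | smul r s hs => exact Submodule.smul_mem _ r hs
  | add s t hs ht => exact add_mem hs ht
  | ι_mul v s hs =>
    induction hs using Submodule.span_induction with
    | zero => simp
    | add s t _ _ hs ht =>
      rw [mul_add]
      exact add_mem hs ht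
    | smul r s _ hs =>
      rw [mul_smul_comm]
      exact Submodule.smul_mem _ r hs
    | mem s hs =>
      obtain ⟨⟨n, y⟩, rfl⟩ := hs
      -- The coefficient of `t` in `(t v + y)^(n+1)` is `(n+1) v y^n`, and `n + 1` is invertible in
      -- characteristic zero.
      have h := mem_of_forall_sum_pow_smul_mem (k := k)
        (Submodule.span k (Set.range fun x : ℕ × V => ιS x.2 ^ x.1)) (n := n + 1 + 1)
        (m := fun i => ((n + 1).choose i : k) • (ιS v ^ i * ιS y ^ (n + 1 - i))) (i := 1)
        (fun t => ?_) (by omega)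
      · rw [Submodule.smul_mem_iff _ (by simp; norm_cast)] at h
        simpa using h
      · refine Submodule.subset_span ⟨(n + 1, t • v + y), ?_⟩
        simp only [map_add, map_smul, add_pow, smul_pow]
        refine Finset.sum_congr rfl fun i _ => ?_
        simp only [Algebra.smul_def, map_natCast, map_pow]
        ring

theorem linearMap_ext_pow [CharZero k] {M : Type*} [AddCommGroup M] [Module k M] {F G : S →ₗ[k] M}
    (h : ∀ n y, F (ιS y ^ n) = G (ιS y ^ n)) : F = G :=
  LinearMap.ext_on_range (span_pow k V) fun x => h x.1 x.2

theorem ι_pow_mem_symPow (n : ℕ) (y : V) : ιS y ^ n ∈ symPow k V n :=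
  Submodule.pow_mem_pow _ (LinearMap.mem_range_self ιS y) n

theorem symPow_eq_span [CharZero k] (n : ℕ) :
    symPow k V n = Submodule.span k (Set.range fun y : V => ιS y ^ n) := by
  refine le_antisymm (fun s hs => ?_) (Submodule.span_le.2 ?_)
  · have h : (⊤ : Submodule k S) ≤ (Submodule.span k (Set.range fun y : V => ιS y ^ n)).comap
        (GradedAlgebra.proj (symPow k V) n) := by
      rw [← span_pow k V, Submodule.span_le]
      rintro _ ⟨⟨m, y⟩, rfl⟩
      simp only [Submodule.comap_coe, Set.mem_preimage, GradedAlgebra.proj_apply, SetLike.mem_coe]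
      rcases eq_or_ne m n with rfl | hm
      · rw [DirectSum.decompose_of_mem_same _ (ι_pow_mem_symPow m y)]
        exact Submodule.subset_span ⟨y, rfl⟩
      · rw [DirectSum.decompose_of_mem_ne _ (ι_pow_mem_symPow m y) hm]
        exact zero_mem _
    have := h (Submodule.mem_top (x := s))
    rwa [Submodule.mem_comap, GradedAlgebra.proj_apply, DirectSum.decompose_of_mem_same _ hs]
      at this
  · rintro _ ⟨y, rfl⟩
    exact ι_pow_mem_symPow n y

/-- The endomorphism that multiplies by `c n` on `Sⁿ V`. -/
def gradedScale (c : ℕ → k) : S →ₗ[k] S :=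
  DirectSum.toModule k ℕ _ (fun n => c n • (symPow k V n).subtype) ∘ₗ
    (DirectSum.decomposeLinearEquiv (symPow k V)).toLinearMap

theorem gradedScale_of_mem (c : ℕ → k) {n : ℕ} {s : S} (hs : s ∈ symPow k V n) :
    gradedScale c s = c n • s := by
  lift s to symPow k V n using hs
  simp [gradedScale]

/-! ### Differential operators from the comultiplication -/

variable (k V) in
/-- The comultiplication of the symmetric algebra, for which `V` is primitive. -/
def comul : S →ₐ[k] S ⊗[k] S :=
  SymmetricAlgebra.lift ((TensorProduct.mk k S S).flip 1 ∘ₗ ιS + TensorProduct.mk k S S 1 ∘ₗ ιS)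

theorem comul_ι (v : V) : comul k V (ιS v) = ιS v ⊗ₜ 1 + 1 ⊗ₜ ιS v := by
  simp [comul]

/-- The operator `s ↦ ∑ C(s₁) s₂` attached to a linear map `C`. -/
def convOp (C : S →ₗ[k] V) : S →ₗ[k] S :=
  LinearMap.mul' k S ∘ₗ (TensorProduct.map (ιS ∘ₗ C) LinearMap.id) ∘ₗ (comul k V).toLinearMap

theorem convOp_add (C D : S →ₗ[k] V) : convOp (C + D) = convOp C + convOp D := by
  simp [convOp, LinearMap.comp_add, LinearMap.add_comp, TensorProduct.map_add_left]

theorem convOp_one (C : S →ₗ[k] V) : convOp C 1 = ιS (C 1) := by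
  simp [convOp, Algebra.TensorProduct.one_def]

/-- Since `v` is primitive, the comultiplication of `v s` splits according to the tensor factor that
receives `v`. This recursion drives the inductions on order and on commutators. -/
theorem convOp_ι_mul (C : S →ₗ[k] V) (v : V) (s : S) :
    convOp C (ιS v * s) = ιS v * convOp C s + convOp (C ∘ₗ LinearMap.mulLeft k (ιS v)) s := by
  simp only [convOp, LinearMap.comp_apply, AlgHom.toLinearMap_apply, map_mul, comul_ι]
  induction comul k V s using TensorProduct.induction_on with
  | zero => simp
  | tmul a b =>
    simp [add_mul]
    ring
  | add x y hx hy =>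
    simp only [mul_add, map_add, hx, hy]
    abel

theorem convOp_pow (C : S →ₗ[k] V) (y : V) (n : ℕ) :
    convOp C (ιS y ^ n) =
      ∑ x ∈ Finset.HasAntidiagonal.antidiagonal n, (n.choose x.1 : k) • (ιS (C (ιS y ^ x.1)) * ιS y ^ x.2) := by
  simp only [convOp, LinearMap.comp_apply, AlgHom.toLinearMap_apply, map_pow, comul_ι]
  rw [Commute.add_pow' (Commute.all _ _), map_sum, map_sum]
  refine Finset.sum_congr rfl fun x _ => ?_
  rw [← Nat.cast_smul_eq_nsmul k]
  simp

theorem mulCommutator_convOp (C : S →ₗ[k] V) (v : V) :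
    mulCommutator (ιS v) (convOp C) = convOp (C ∘ₗ LinearMap.mulLeft k (ιS v)) := by
  ext s
  simp [convOp_ι_mul]

/-- `convOp C` is a differential operator of order `< q` if `C` vanishes in the degrees `≥ q`. -/
theorem convOp_mem_diffOp {q : ℕ} {C : S →ₗ[k] V}
    (hC : ∀ n, q ≤ n → ∀ s ∈ symPow k V n, C s = 0) : convOp C ∈ diffOp k S q := by
  induction q generalizing C with
  | zero =>
    have : C = 0 := by
      classical
      ext s
      rw [← DirectSum.sum_support_decompose (symPow k V) s, map_sum]
      exact Finset.sum_eq_zero fun n _ => hC n (Nat.zero_le n) _ (SetLike.coe_mem _)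
    rw [mem_diffOp_zero, this]
    ext s
    simp [convOp]
  | succ q ih =>
    refine mem_diffOp_succ_of_adjoin (adjoin_range_ι k V) ?_
    rintro _ ⟨v, rfl⟩
    rw [mulCommutator_convOp]
    -- Precomposing with multiplication by `v` raises the degree of the argument by one, so the
    -- vanishing bound drops from `q + 1` to `q`.
    refine ih fun n hn s hs => hC (1 + n) (by omega) _ ?_
    exact SetLike.mul_mem_graded (ι_mem_symPow k V v) hs

/-- The operators `convOp C` form a Lie algebra. -/
theorem convOp_commutator (C D : S →ₗ[k] V) (s : S) :
    convOp C (convOp D s) - convOp D (convOp C s) =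
      convOp (C ∘ₗ convOp D - D ∘ₗ convOp C) s := by
  induction s using symmetricAlgebra_induction generalizing C D with
  | one =>
    have h (C D : S →ₗ[k] V) :
        convOp C (convOp D 1) = ιS (D 1) * ιS (C 1) + ιS (C (convOp D 1)) := by
      rw [convOp_one, ← mul_one (ιS (D 1)), convOp_ι_mul, convOp_one, convOp_one]
      simp
    rw [h, h, convOp_one (C ∘ₗ convOp D - D ∘ₗ convOp C)]
    simp only [LinearMap.sub_apply, LinearMap.comp_apply, map_sub]
    ring
  | smul r s h => rw [map_smul, map_smul, map_smul, map_smul, map_smul, ← smul_sub, h]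
  | add s t hs ht =>
    simp only [map_add]
    rw [← hs, ← ht]
    abel
  | ι_mul v s h =>
    -- Leibniz rule for `C ↦ C(v ·)` on the bracket. The induction hypothesis is then used for three
    -- pairs: the original one and those with one entry precomposed, hence the generalization over
    -- `C` and `D`.
    have e : (C ∘ₗ convOp D - D ∘ₗ convOp C) ∘ₗ LinearMap.mulLeft k (ιS v) =
        ((C ∘ₗ LinearMap.mulLeft k (ιS v)) ∘ₗ convOp D -
          D ∘ₗ convOp (C ∘ₗ LinearMap.mulLeft k (ιS v))) +
        (C ∘ₗ convOp (D ∘ₗ LinearMap.mulLeft k (ιS v)) -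
          (D ∘ₗ LinearMap.mulLeft k (ιS v)) ∘ₗ convOp C) := by
      ext s
      simp only [LinearMap.comp_apply, LinearMap.sub_apply, LinearMap.add_apply,
        LinearMap.mulLeft_apply, convOp_ι_mul, map_add]
      abel
    rw [convOp_ι_mul (C ∘ₗ convOp D - D ∘ₗ convOp C), e, convOp_add, LinearMap.add_apply, ← h, ← h, ← h]
    simp only [convOp_ι_mul, map_add, mul_sub]
    abel

end SymmetricAlgebra

end PBW

end

noncomputable section

namespace PBW

/-! ### The functional equation of the Bernoulli series and its Lie form -/

section Bernoulli

open PowerSeries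

variable {R : Type*} [CommRing R]

/-- `(f((a + b) X) - f(a X)) / (b X)`, written out. -/
def diffQuot (f : ℕ → R) (a b : R) : R⟦X⟧ :=
  PowerSeries.mk fun q => f (q + 1) * ∑ i ∈ Finset.range (q + 1), (a + b) ^ i * a ^ (q - i)

theorem C_mul_X_mul_diffQuot (f : ℕ → R) (a b : R) :
    C b * X * diffQuot f a b =
      rescale (a + b) (PowerSeries.mk f) - rescale a (PowerSeries.mk f) := by
  ext n
  rw [mul_assoc, coeff_C_mul]
  cases n with
  | zero => rw [map_sub, coeff_rescale, coeff_rescale, coeff_zero_X_mul]; simp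
  | succ n =>
    have h := (Commute.all (a + b) a).geom_sum₂_mul (n + 1)
    rw [add_sub_cancel_left] at h
    rw [coeff_succ_X_mul, diffQuot, coeff_mk, map_sub, coeff_rescale, coeff_rescale, coeff_mk,
      ← sub_mul, ← h]
    simp only [Nat.add_sub_cancel]
    ring

/-- Euler's identity for the generating function of the Bernoulli numbers. -/
theorem bernoulli_euler [Algebra ℚ R] [IsDomain R] {a b : R} (ha : a ≠ 0) (hb : b ≠ 0) (hab : a + b ≠ 0) :
    rescale b (bernoulliPowerSeries R) *
        diffQuot (fun n => algebraMap ℚ R (bernoulli n / n.factorial)) a b +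
      rescale a (bernoulliPowerSeries R) *
        diffQuot (fun n => algebraMap ℚ R (bernoulli n / n.factorial)) b a =
      -rescale (a + b) (bernoulliPowerSeries R) := by
  have hφ (c : R) : rescale c (bernoulliPowerSeries R) * (rescale c (exp R) - 1) = C c * X := by
    have := congrArg (rescale c) (bernoulliPowerSeries_mul_exp_sub_one R)
    simpa [rescale_X] using this
  have hE := exp_mul_exp_eq_exp_add a b
  have hX (c : R) (hc : c ≠ 0) : C c * X ≠ (0 : R⟦X⟧) :=
    mul_ne_zero ((map_ne_zero_iff _ C_injective).2 hc) X_ne_zero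
  have hE0 (c : R) (hc : c ≠ 0) : rescale c (exp R) - 1 ≠ 0 := fun h => by
    have := hφ c
    rw [h, mul_zero] at this
    exact hX c hc this.symm
  have h₁ := C_mul_X_mul_diffQuot (fun n => algebraMap ℚ R (bernoulli n / n.factorial)) a b
  have h₂ := C_mul_X_mul_diffQuot (fun n => algebraMap ℚ R (bernoulli n / n.factorial)) b a
  rw [add_comm b a] at h₂
  change _ = rescale (a + b) (bernoulliPowerSeries R) - rescale a (bernoulliPowerSeries R) at h₁
  change _ = rescale (a + b) (bernoulliPowerSeries R) - rescale b (bernoulliPowerSeries R) at h₂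
  have hφa := hφ a
  have hφb := hφ b
  have hφc := hφ (a + b)
  have hEa := hE0 a ha
  have hEb := hE0 b hb
  have hEc := hE0 (a + b) hab
  have hXa := hX a ha
  have hXb := hX b hb
  rw [← hE, map_add] at *
  generalize rescale (a + b) (bernoulliPowerSeries R) = φc at *
  generalize rescale a (bernoulliPowerSeries R) = φa at *
  generalize rescale b (bernoulliPowerSeries R) = φb at *
  generalize rescale a (exp R) = Ea at *
  generalize rescale b (exp R) = Eb at *
  generalize diffQuot _ a b = Q₁ at *
  generalize diffQuot _ b a = Q₂ at *
  generalize (C a : R⟦X⟧) = α at *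
  generalize (C b : R⟦X⟧) = β at *
  -- Product of all denominators. After multiplying by it, only the relations `φ(cX)(e^(cX) - 1) =
  -- cX` for `c = a, b, a + b` and the two difference quotients are needed, with `e^((a+b)X)`
  -- already written as `Ea * Eb`.
  have h0 := mul_ne_zero (mul_ne_zero hXa hXb) (mul_ne_zero hEa (mul_ne_zero hEb hEc))
  refine mul_left_cancel₀ h0 ?_
  linear_combination
    α * X * (Ea - 1) * (Eb - 1) * (Ea * Eb - 1) * φb * h₁ +
    β * X * (Ea - 1) * (Eb - 1) * (Ea * Eb - 1) * φa * h₂ +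
    (α * X * (Ea - 1) * (Ea * Eb - 1) * (φc - φa) - α * X * (β * X) * (Ea * Eb - 1)) * hφb +
    (β * X * (Eb - 1) * (Ea * Eb - 1) * (φc - φb) - α * X * (β * X) * (Ea * Eb - 1)) * hφa +
    α * X * (β * X) * (Ea * Eb - 1) * hφc

section Lie

variable {k g : Type*} [Field k] [LieRing g] [LieAlgebra k g]

/-- The linear map from polynomials in two variables to `g` that sends `X₁^i X₂^j` to
`[ad_y^i x, ad_y^j x']`. -/
def bracketEval (y x x' : g) : MvPolynomial Bool k →ₗ[k] g :=
  (MvPolynomial.basisMonomials Bool k).constr k fun m =>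
    ⁅(LieAlgebra.ad k g y ^ m true) x, (LieAlgebra.ad k g y ^ m false) x'⁆

theorem bracketEval_monomial (y x x' : g) (i j : ℕ) :
    bracketEval (k := k) y x x' (MvPolynomial.X true ^ i * MvPolynomial.X false ^ j) =
      ⁅(LieAlgebra.ad k g y ^ i) x, (LieAlgebra.ad k g y ^ j) x'⁆ := by
  have : (MvPolynomial.X true ^ i * MvPolynomial.X false ^ j : MvPolynomial Bool k) =
      MvPolynomial.basisMonomials Bool k (Finsupp.single true i + Finsupp.single false j) := by
    simp [MvPolynomial.X_pow_eq_monomial, MvPolynomial.monomial_mul]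
  rw [this, bracketEval, Module.Basis.constr_basis]
  simp

/-- The Jacobi identity: `ad_y` acts on a bracket as the sum of its actions on the two entries. -/
theorem bracketEval_sum_mul (y x x' : g) (P : MvPolynomial Bool k) :
    bracketEval y x x' ((MvPolynomial.X true + MvPolynomial.X false) * P) =
      ⁅y, bracketEval y x x' P⁆ := by
  suffices h : bracketEval y x x' ∘ₗ
      LinearMap.mulLeft k (MvPolynomial.X true + MvPolynomial.X false) =
      LieAlgebra.ad k g y ∘ₗ bracketEval y x x' from LinearMap.congr_fun h P
  refine (MvPolynomial.basisMonomials Bool k).ext fun m => ?_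
  have hm : MvPolynomial.basisMonomials Bool k m =
      MvPolynomial.X true ^ m true * MvPolynomial.X false ^ m false := by
    rw [MvPolynomial.coe_basisMonomials, MvPolynomial.X_pow_eq_monomial,
      MvPolynomial.X_pow_eq_monomial, MvPolynomial.monomial_mul, mul_one]
    congr 1
    ext b
    cases b <;> simp
  rw [hm]
  simp only [LinearMap.comp_apply, LinearMap.mulLeft_apply, LieAlgebra.ad_apply]
  rw [bracketEval_monomial, leibniz_lie, add_mul, map_add, ← mul_assoc, ← pow_succ',
    mul_left_comm, ← pow_succ', bracketEval_monomial, bracketEval_monomial, pow_succ', pow_succ']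
  rfl

theorem bracketEval_sum_pow_mul (y x x' : g) (n : ℕ) (P : MvPolynomial Bool k) :
    bracketEval y x x' ((MvPolynomial.X true + MvPolynomial.X false) ^ n * P) =
      (LieAlgebra.ad k g y ^ n) (bracketEval y x x' P) := by
  induction n with
  | zero => simp
  | succ n ih =>
    rw [pow_succ', mul_assoc, bracketEval_sum_mul, ih, pow_succ']
    rfl

variable [CharZero k]

variable (k) in
/-- The coefficient of `tⁿ` in `t / (eᵗ - 1)`. -/
def bernoulliCoeff (n : ℕ) : k := algebraMap ℚ k (bernoulli n / n.factorial)

/-- This is the image under `bracketEval` of the `n`-th coefficient of `bernoulli_euler`, where `a`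
and `b` are the variables recording `ad_y` on `x` and on `x'`; their sum becomes `ad_y` on the whole
bracket. -/
theorem bernoulliCoeff_bracket (y x x' : g) (n : ℕ) :
    ∑ p ∈ Finset.HasAntidiagonal.antidiagonal n,
        (bernoulliCoeff k p.1 * bernoulliCoeff k (p.2 + 1)) •
          ∑ i ∈ Finset.range (p.2 + 1), (LieAlgebra.ad k g y ^ i)
            ⁅(LieAlgebra.ad k g y ^ p.1) x', (LieAlgebra.ad k g y ^ (p.2 - i)) x⁆ -
      ∑ p ∈ Finset.HasAntidiagonal.antidiagonal n,
        (bernoulliCoeff k p.1 * bernoulliCoeff k (p.2 + 1)) •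
          ∑ i ∈ Finset.range (p.2 + 1), (LieAlgebra.ad k g y ^ i)
            ⁅(LieAlgebra.ad k g y ^ p.1) x, (LieAlgebra.ad k g y ^ (p.2 - i)) x'⁆ =
      bernoulliCoeff k n • (LieAlgebra.ad k g y ^ n) ⁅x, x'⁆ := by
  have hab : (MvPolynomial.X true + MvPolynomial.X false : MvPolynomial Bool k) ≠ 0 := fun h => by
    have := congrArg (MvPolynomial.eval fun b => if b then (1 : k) else 0) h
    simp at this
  have h := congrArg (bracketEval y x x') (congrArg (coeff n) (bernoulli_euler
    (MvPolynomial.X_ne_zero (R := k) true) (MvPolynomial.X_ne_zero (R := k) false) hab))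
  have hc (m : ℕ) : algebraMap ℚ (MvPolynomial Bool k) (bernoulli m / m.factorial) =
      algebraMap k _ (bernoulliCoeff k m) := rfl
  simp only [map_add, map_neg, coeff_mul, coeff_rescale, diffQuot, coeff_mk,
    bernoulliPowerSeries, hc, map_sum] at h
  rw [← neg_inj, neg_sub, sub_eq_neg_add, ← Finset.sum_neg_distrib]
  have hn : bracketEval y x x' ((MvPolynomial.X true + MvPolynomial.X false) ^ n *
      algebraMap k (MvPolynomial Bool k) (bernoulliCoeff k n)) =
      bernoulliCoeff k n • (LieAlgebra.ad k g y ^ n) ⁅x, x'⁆ := by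
    have := bracketEval_monomial (k := k) y x x' 0 0
    simp only [pow_zero, mul_one, Module.End.one_apply] at this
    rw [bracketEval_sum_pow_mul, Algebra.algebraMap_eq_smul_one, map_smul, this, map_smul]
  rw [hn] at h
  rw [← h]
  congr 1
  · refine Finset.sum_congr rfl fun p _ => ?_
    have e : (MvPolynomial.X false ^ p.1 * algebraMap k _ (bernoulliCoeff k p.1) *
        (algebraMap k _ (bernoulliCoeff k (p.2 + 1)) * ∑ i ∈ Finset.range (p.2 + 1),
          (MvPolynomial.X true + MvPolynomial.X false) ^ i * MvPolynomial.X true ^ (p.2 - i)) :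
          MvPolynomial Bool k) =
        (bernoulliCoeff k p.1 * bernoulliCoeff k (p.2 + 1)) • ∑ i ∈ Finset.range (p.2 + 1),
          (MvPolynomial.X true + MvPolynomial.X false) ^ i *
            (MvPolynomial.X true ^ (p.2 - i) * MvPolynomial.X false ^ p.1) := by
      simp only [← mul_assoc, ← Finset.sum_mul, Algebra.smul_def, map_mul]
      ring
    rw [e, map_smul, map_sum, ← smul_neg, ← Finset.sum_neg_distrib]
    congr 1
    refine Finset.sum_congr rfl fun i _ => ?_
    rw [bracketEval_sum_pow_mul, bracketEval_monomial, ← map_neg, lie_skew]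
  · refine Finset.sum_congr rfl fun p _ => ?_
    have e : (MvPolynomial.X true ^ p.1 * algebraMap k _ (bernoulliCoeff k p.1) *
        (algebraMap k _ (bernoulliCoeff k (p.2 + 1)) * ∑ i ∈ Finset.range (p.2 + 1),
          (MvPolynomial.X false + MvPolynomial.X true) ^ i * MvPolynomial.X false ^ (p.2 - i)) :
          MvPolynomial Bool k) =
        (bernoulliCoeff k p.1 * bernoulliCoeff k (p.2 + 1)) • ∑ i ∈ Finset.range (p.2 + 1),
          (MvPolynomial.X true + MvPolynomial.X false) ^ i *
            (MvPolynomial.X true ^ p.1 * MvPolynomial.X false ^ (p.2 - i)) := by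
      simp only [mul_left_comm _ (MvPolynomial.X true ^ p.1), ← Finset.mul_sum, Algebra.smul_def,
        map_mul, add_comm (MvPolynomial.X false) (MvPolynomial.X true)]
      ring
    rw [e, map_smul, map_sum]
    congr 1
    refine Finset.sum_congr rfl fun i _ => ?_
    rw [bracketEval_sum_pow_mul, bracketEval_monomial]

end Lie

end Bernoulli

end PBW

end

noncomputable section

namespace PBW

attribute [local instance] LieRing.ofAssociativeRing

theorem prod_ofFn_ite {M : Type*} [Monoid M] (y z : M) (n : ℕ) (i : Fin (n + 1)) :
    (List.ofFn fun j => if j = i then z else y).prod = y ^ (i : ℕ) * z * y ^ (n - i) := by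
  induction n with
  | zero => simp [Fin.eq_zero i]
  | succ n ih =>
    rw [List.ofFn_succ, List.prod_cons]
    induction i using Fin.cases with
    | zero => simp [Fin.succ_ne_zero, pow_succ']
    | succ i =>
      simp only [Fin.succ_inj, ih, (Fin.succ_ne_zero i).symm, if_false, Fin.val_succ,
        Nat.add_sub_add_right, pow_succ', mul_assoc]

theorem sum_perm_symm_zero {M : Type*} [AddCommMonoid M] (n : ℕ) (f : Fin (n + 1) → M) :
    ∑ σ : Equiv.Perm (Fin (n + 1)), f (σ.symm 0) = n.factorial • ∑ i, f i := by
  rw [← Equiv.sum_comp (Equiv.inv (Equiv.Perm (Fin (n + 1)))),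
    ← Equiv.sum_comp Equiv.Perm.decomposeFin.symm, Fintype.sum_prod_type, Finset.smul_sum]
  refine Finset.sum_congr rfl fun i _ => ?_
  simp only [Equiv.inv_apply, ← Equiv.Perm.inv_def, inv_inv, Equiv.Perm.decomposeFin_symm_apply_zero]
  rw [Finset.sum_const, Finset.card_univ, Fintype.card_perm, Fintype.card_fin]

/-! ### Reordering products modulo shorter words -/

section EnvelopingFiltration

variable {k g : Type*} [Field k] [LieRing g] [LieAlgebra k g]

local notation "U" => UniversalEnvelopingAlgebra k g
local notation "ιU" => UniversalEnvelopingAlgebra.ι k (L := g)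

variable (k g) in
/-- The filtration of the enveloping algebra, starting with `0`: the span of the products of fewer
than `n` elements of `g`. -/
def envFiltration (n : ℕ) : Submodule k U :=
  Submodule.span k {u | ∃ l : List g, l.length < n ∧ (l.map ιU).prod = u}

theorem ι_mul_mem_envFiltration (x : g) {n : ℕ} {u : U} (hu : u ∈ envFiltration k g n) :
    ιU x * u ∈ envFiltration k g (n + 1) := by
  induction hu using Submodule.span_induction with
  | zero => simp
  | add u v _ _ hu hv =>
    rw [mul_add]
    exact add_mem hu hv
  | smul r u _ hu =>
    rw [mul_smul_comm]
    exact Submodule.smul_mem _ r hu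
  | mem u hu =>
    obtain ⟨l, hl, rfl⟩ := hu
    exact Submodule.subset_span ⟨x :: l, by simpa using hl, by simp⟩

/-- An adjacent swap changes a word by the same word with two letters replaced by their bracket,
which is strictly shorter. -/
theorem prod_sub_prod_mem_envFiltration {l l' : List g} (h : l.Perm l') :
    (l.map ιU).prod - (l'.map ιU).prod ∈ envFiltration k g l.length := by
  induction h with
  | nil => simp
  | cons x _ ih =>
    simp only [List.map_cons, List.prod_cons, ← mul_sub, List.length_cons]
    exact ι_mul_mem_envFiltration x ih
  | swap x y l =>
    refine Submodule.subset_span ⟨⁅y, x⁆ :: l, by simp, ?_⟩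
    simp [LieRing.of_associative_ring_bracket, sub_mul, mul_assoc]
  | trans h _ ih ih' =>
    rw [← sub_add_sub_cancel]
    refine add_mem ih ?_
    rwa [h.length_eq]

end EnvelopingFiltration

/-! ### Symmetrization of powers -/

section Symmetrization

variable {k g : Type*} [Field k] [CharZero k] [LieRing g] [LieAlgebra k g]

local notation "S" => SymmetricAlgebra k g
local notation "ιS" => SymmetricAlgebra.ι k g
local notation "U" => UniversalEnvelopingAlgebra k g
local notation "ιU" => UniversalEnvelopingAlgebra.ι k (L := g)

theorem symmetrization_pow (y : g) (n : ℕ) : symmetrization k g (ιS y ^ n) = ιU y ^ n := by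
  have h := symmetrization_prod k g n fun _ => y
  have h0 : (n.factorial : k) ≠ 0 := by exact_mod_cast n.factorial_ne_zero
  rw [Finset.prod_const, Finset.card_univ, Fintype.card_fin] at h
  rw [h, List.ofFn_const, List.prod_replicate, Finset.sum_const, Finset.card_univ,
    Fintype.card_perm, Fintype.card_fin, ← Nat.cast_smul_eq_nsmul k, smul_smul, inv_mul_cancel₀ h0,
    one_smul]

/-- A permuted word depends only on the position of `z`, and each position arises from `n!`
permutations. -/
theorem symmetrization_ι_mul_pow (y z : g) (n : ℕ) :
    symmetrization k g (ιS z * ιS y ^ n) =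
      (n + 1 : k)⁻¹ • ∑ i ∈ Finset.range (n + 1), ιU y ^ i * ιU z * ιU y ^ (n - i) := by
  have h := symmetrization_prod k g (n + 1) (Fin.cons z fun _ => y)
  rw [Fin.prod_univ_succ] at h
  simp only [Fin.cons_zero, Fin.cons_succ, Finset.prod_const, Finset.card_univ,
    Fintype.card_fin] at h
  have h' (σ : Equiv.Perm (Fin (n + 1))) :
      (List.ofFn fun i => ιU ((Fin.cons z fun _ => y : Fin (n + 1) → g) (σ i))).prod =
        ιU y ^ (σ.symm 0 : ℕ) * ιU z * ιU y ^ (n - (σ.symm 0 : ℕ)) := by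
    rw [← prod_ofFn_ite]
    congr 2
    funext i
    rw [← apply_ite ιU]
    congr 1
    by_cases hi : σ i = 0
    · rw [if_pos (by rw [← hi, Equiv.symm_apply_apply]), hi, Fin.cons_zero]
    · rw [if_neg fun h => hi (by rw [h, Equiv.apply_symm_apply])]
      obtain ⟨j, hj⟩ := Fin.exists_succ_eq.2 hi
      rw [← hj, Fin.cons_succ]
  have h0 : (n.factorial : k) ≠ 0 := by exact_mod_cast n.factorial_ne_zero
  rw [h, Finset.sum_congr rfl fun σ _ => h' σ,
    sum_perm_symm_zero n fun i => ιU y ^ (i : ℕ) * ιU z * ιU y ^ (n - (i : ℕ)),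
    Fin.sum_univ_eq_sum_range fun i => ιU y ^ i * ιU z * ιU y ^ (n - i),
    ← Nat.cast_smul_eq_nsmul k, smul_smul]
  congr 1
  rw [Nat.factorial_succ]
  push_cast
  field_simp

/-! ### The regular representation on the symmetric algebra -/

variable (k g) in
/-- The adjoint action of symmetrized elements: `y ^ n` sends `x` to `ad_y^n x`. -/
def adEval : g →ₗ[k] S →ₗ[k] g :=
  ((UniversalEnvelopingAlgebra.lift k (LieAlgebra.ad k g)).toLinearMap ∘ₗ
    symmetrization k g).flip

theorem adEval_pow (x y : g) (n : ℕ) :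
    adEval k g x (ιS y ^ n) = (LieAlgebra.ad k g y ^ n) x := by
  simp [adEval, symmetrization_pow]

theorem adEval_ι_mul_pow (x y z : g) (n : ℕ) :
    adEval k g x (ιS z * ιS y ^ n) = (n + 1 : k)⁻¹ • ∑ i ∈ Finset.range (n + 1),
      (LieAlgebra.ad k g y ^ i) ⁅z, (LieAlgebra.ad k g y ^ (n - i)) x⁆ := by
  simp [adEval, symmetrization_ι_mul_pow]

/-- The linear map with `y ^ n ↦ cₙ ad_y^n x`. -/
def scaleEval (c : ℕ → k) (x : g) : S →ₗ[k] g := adEval k g x ∘ₗ gradedScale c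

theorem scaleEval_pow (c : ℕ → k) (x y : g) (n : ℕ) :
    scaleEval c x (ιS y ^ n) = c n • (LieAlgebra.ad k g y ^ n) x := by
  rw [scaleEval, LinearMap.comp_apply, gradedScale_of_mem _ (ι_pow_mem_symPow n y), map_smul,
    adEval_pow]

variable (k) in
/-- The linear map with `y ^ n ↦ Bₙ ad_y^n x`, where `Bₙ` is the Bernoulli number. -/
def bernoulliEval (x : g) : S →ₗ[k] g :=
  scaleEval (fun n => bernoulliCoeff k n * n.factorial) x

theorem bernoulliEval_pow (x y : g) (n : ℕ) :
    bernoulliEval k x (ιS y ^ n) =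
      (bernoulliCoeff k n * n.factorial) • (LieAlgebra.ad k g y ^ n) x :=
  scaleEval_pow _ x y n

theorem bernoulliEval_ι_mul_pow (x y z : g) (n : ℕ) :
    bernoulliEval k x (ιS z * ιS y ^ n) =
      (bernoulliCoeff k (n + 1) * n.factorial) • ∑ i ∈ Finset.range (n + 1),
      (LieAlgebra.ad k g y ^ i) ⁅z, (LieAlgebra.ad k g y ^ (n - i)) x⁆ := by
  have hmem : ιS z * ιS y ^ n ∈ symPow k g (1 + n) :=
    SetLike.mul_mem_graded (ι_mem_symPow k g z) (ι_pow_mem_symPow n y)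
  have h0 : (n + 1 : k) ≠ 0 := by exact_mod_cast n.succ_ne_zero
  rw [bernoulliEval, scaleEval, LinearMap.comp_apply, gradedScale_of_mem _ hmem, map_smul,
    adEval_ι_mul_pow, smul_smul, add_comm 1 n, Nat.factorial_succ]
  congr 1
  push_cast
  field_simp

theorem bernoulliEval_convOp (x x' y : g) (n : ℕ) :
    bernoulliEval k x (convOp (bernoulliEval k x') (ιS y ^ n)) =
      (n.factorial : k) • ∑ p ∈ Finset.HasAntidiagonal.antidiagonal n,
        (bernoulliCoeff k p.1 * bernoulliCoeff k (p.2 + 1)) •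
          ∑ i ∈ Finset.range (p.2 + 1), (LieAlgebra.ad k g y ^ i)
            ⁅(LieAlgebra.ad k g y ^ p.1) x', (LieAlgebra.ad k g y ^ (p.2 - i)) x⁆ := by
  rw [convOp_pow, map_sum, Finset.smul_sum]
  refine Finset.sum_congr rfl fun p hp => ?_
  rw [map_smul, bernoulliEval_pow, map_smul, smul_mul_assoc, map_smul, bernoulliEval_ι_mul_pow,
    smul_smul, smul_smul, smul_smul]
  congr 1
  rw [Finset.HasAntidiagonal.mem_antidiagonal] at hp
  have := Nat.choose_mul_factorial_mul_factorial (show p.1 ≤ n by omega)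
  rw [← this, show n - p.1 = p.2 by omega]
  push_cast
  ring

/-- The flatness that makes `leftRep` a representation. On powers of `y`, which suffice by
polarization, it is `bernoulliCoeff_bracket` multiplied by `n!`. -/
theorem bernoulliEval_commutator (x x' : g) :
    bernoulliEval k x ∘ₗ convOp (bernoulliEval k x') -
      bernoulliEval k x' ∘ₗ convOp (bernoulliEval k x) = bernoulliEval k ⁅x, x'⁆ := by
  refine linearMap_ext_pow fun n y => ?_
  rw [LinearMap.sub_apply, LinearMap.comp_apply, LinearMap.comp_apply, bernoulliEval_convOp,
    bernoulliEval_convOp, ← smul_sub, bernoulliCoeff_bracket, bernoulliEval_pow, smul_smul,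
    mul_comm]

variable (k g) in
/-- The action of `g` on its symmetric algebra that corresponds to the left multiplication of the
enveloping algebra. -/
def leftRep : g →ₗ⁅k⁆ Module.End k S where
  toFun x := convOp (bernoulliEval k x)
  map_add' x y := by
    rw [← convOp_add]
    congr 1
    ext s
    simp [bernoulliEval, scaleEval]
  map_smul' r x := by
    refine linearMap_ext_pow fun n y => ?_
    simp [convOp_pow, bernoulliEval_pow, Finset.smul_sum, smul_comm r]
  map_lie' {x y} := by
    ext s
    rw [← bernoulliEval_commutator, ← convOp_commutator, LieRing.of_associative_ring_bracket]
    rfl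

theorem leftRep_apply (x : g) : leftRep k g x = convOp (bernoulliEval k x) := rfl

/-- Since `ad_y y = 0`, only the term with `B_0 = 1` survives. -/
theorem leftRep_self_pow (y : g) (n : ℕ) : leftRep k g y (ιS y ^ n) = ιS y ^ (n + 1) := by
  rw [leftRep_apply, convOp_pow, Finset.sum_eq_single (0, n)]
  · rw [bernoulliEval_pow, pow_succ']
    simp [bernoulliCoeff]
  · rintro ⟨p, q⟩ hpq hp
    rw [Finset.HasAntidiagonal.mem_antidiagonal] at hpq
    cases p with
    | zero => exact absurd (by simpa using hpq) hp
    | succ p =>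
      rw [bernoulliEval_pow, pow_succ (LieAlgebra.ad k g y)]
      simp
  · simp

variable (k g) in
/-- The action of the enveloping algebra on `1` in `leftRep`. -/
def unsymmetrize : U →ₗ[k] S :=
  LinearMap.applyₗ 1 ∘ₗ (UniversalEnvelopingAlgebra.lift k (leftRep k g)).toLinearMap

theorem unsymmetrize_ι_mul (x : g) (u : U) :
    unsymmetrize k g (ιU x * u) = leftRep k g x (unsymmetrize k g u) := by
  simp [unsymmetrize]

theorem unsymmetrize_ι_pow_mul (x : g) (n : ℕ) (u : U) :
    unsymmetrize k g (ιU x ^ n * u) = (leftRep k g x ^ n) (unsymmetrize k g u) := by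
  simp [unsymmetrize]

theorem unsymmetrize_symmetrization (s : S) :
    unsymmetrize k g (symmetrization k g s) = s := by
  suffices h : unsymmetrize k g ∘ₗ symmetrization k g = LinearMap.id from LinearMap.congr_fun h s
  refine linearMap_ext_pow fun n y => ?_
  rw [LinearMap.comp_apply, symmetrization_pow, LinearMap.id_apply]
  induction n with
  | zero => simp [unsymmetrize]
  | succ n ih => rw [pow_succ', unsymmetrize_ι_mul, ih, leftRep_self_pow]

/-! ### Surjectivity of the symmetrization -/

/-- A word differs from each of its permutations by shorter words, which are in the range by
induction. Summing over permutations gives `n!` times the word modulo the range, and the sum of the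
permuted words is `n!` times a symmetrized monomial. -/
theorem prod_mem_range_symmetrization (l : List g) :
    (l.map ιU).prod ∈ LinearMap.range (symmetrization k g) := by
  induction h : l.length using Nat.strong_induction_on generalizing l with
  | _ n ih =>
    subst h
    have hle : envFiltration k g l.length ≤ LinearMap.range (symmetrization k g) := by
      refine Submodule.span_le.2 ?_
      rintro _ ⟨l', hl', rfl⟩
      exact ih _ hl' l' rfl
    have hs := symmetrization_prod k g l.length l.get
    have hperm (σ : Equiv.Perm (Fin l.length)) :
        (l.map ιU).prod - (List.ofFn fun i => ιU (l.get (σ i))).prod ∈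
          LinearMap.range (symmetrization k g) := by
      have e : (List.ofFn fun i => ιU (l.get (σ i))) = (List.ofFn (l.get ∘ σ)).map ιU := by
        rw [List.map_ofFn]
        rfl
      rw [e]
      refine hle (prod_sub_prod_mem_envFiltration (List.Perm.symm ?_))
      simpa using Equiv.Perm.ofFn_comp_perm σ l.get
    have h0 : (l.length.factorial : k) ≠ 0 := by exact_mod_cast l.length.factorial_ne_zero
    have hsum := Submodule.sum_mem _ fun σ (_ : σ ∈ Finset.univ) => hperm σ
    have hS : ∑ σ : Equiv.Perm (Fin l.length), (List.ofFn fun i => ιU (l.get (σ i))).prod ∈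
        LinearMap.range (symmetrization k g) := by
      rw [← Submodule.smul_mem_iff _ (inv_ne_zero h0), ← hs]
      exact ⟨_, rfl⟩
    rw [Finset.sum_sub_distrib] at hsum
    have := (Submodule.sub_mem_iff_left _ hS).1 hsum
    rwa [Finset.sum_const, Finset.card_univ, Fintype.card_perm, Fintype.card_fin,
      ← Nat.cast_smul_eq_nsmul k, Submodule.smul_mem_iff _ h0] at this

variable (k g)

theorem symmetrization_surjective : Function.Surjective (symmetrization k g) := by
  intro u
  have hu : u ∈ LinearMap.range (UniversalEnvelopingAlgebra.mkAlgHom k g).toLinearMap :=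
    Quotient.mk_surjective u
  obtain ⟨t, rfl⟩ := hu
  have ht : t ∈ Submodule.span k (Set.range fun l : List g => (l.map (TensorAlgebra.ι k)).prod) :=
    tensor_span k g ▸ Submodule.mem_top
  rw [← Set.mem_range, ← LinearMap.coe_range, SetLike.mem_coe]
  induction ht using Submodule.span_induction with
  | zero => simp
  | add a b _ _ ha hb =>
    rw [map_add]
    exact add_mem ha hb
  | smul r a _ ha =>
    rw [map_smul]
    exact Submodule.smul_mem _ r ha
  | mem a ha =>
    obtain ⟨l, rfl⟩ := ha
    convert prod_mem_range_symmetrization (k := k) l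
    simp only [AlgHom.toLinearMap_apply, map_list_prod, List.map_map]
    rfl

/-- The Poincaré–Birkhoff–Witt theorem in characteristic zero. -/
theorem symmetrization_bijective : Function.Bijective (symmetrization k g) :=
  ⟨Function.LeftInverse.injective unsymmetrize_symmetrization, symmetrization_surjective k g⟩

theorem symmetrizationInv_eq : symmetrizationInv k g = unsymmetrize k g := by
  ext u
  obtain ⟨s, rfl⟩ := symmetrization_surjective k g u
  rw [unsymmetrize_symmetrization, symmetrizationInv, dif_pos (symmetrization_bijective k g)]
  exact (LinearEquiv.ofBijective _ (symmetrization_bijective k g)).symm_apply_apply s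

end Symmetrization

end PBW

end

noncomputable section

namespace PBW

attribute [local instance] LieRing.ofAssociativeRing

/-! ### Operators graded by degree and order -/

section HomogeneousParts

variable {k V : Type*} [Field k] [AddCommGroup V] [Module k V]

local notation "S" => SymmetricAlgebra k V
local notation "ιS" => SymmetricAlgebra.ι k V

/-- `T` is the sum of the operators `F p`, where `F p` is homogeneous of degree `d - p` and a
differential operator of order `≤ p`. -/
structure IsSumOfParts (d : ℕ) (T : S →ₗ[k] S) (F : ℕ → S →ₗ[k] S) : Prop where
  mem_diffOp : ∀ p, F p ∈ diffOp k S (p + 1)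
  mem_symPow : ∀ {m p s}, s ∈ symPow k V m → p ≤ m + d → F p s ∈ symPow k V (m + d - p)
  eq_zero : ∀ {m p s}, s ∈ symPow k V m → m + d < p → F p s = 0
  eq_sum : ∀ {m s}, s ∈ symPow k V m → T s = ∑ p ∈ Finset.range (m + d + 1), F p s

theorem IsSumOfParts.one :
    IsSumOfParts 0 (1 : Module.End k S) (Pi.single 0 (1 : Module.End k S)) where
  mem_diffOp p := by
    rcases eq_or_ne p 0 with rfl | hp
    · rw [mem_diffOp_succ]
      intro a
      rw [mem_diffOp_zero]
      ext b
      simp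
    · rw [Pi.single_eq_of_ne hp]
      exact zero_mem _
  mem_symPow {m p s} hs _ := by
    rcases eq_or_ne p 0 with rfl | hp
    · simpa using hs
    · simp [Pi.single_eq_of_ne hp]
  eq_zero {m p s} _ hp := by
    simp [Pi.single_eq_of_ne (show p ≠ 0 by omega)]
  eq_sum {m s} _ := by
    rw [Finset.sum_eq_single 0]
    · simp
    · intro p _ hp
      simp [Pi.single_eq_of_ne hp]
    · simp

theorem IsSumOfParts.mul {d e : ℕ} {T T' : Module.End k S} {F G : ℕ → Module.End k S}
    (hT : IsSumOfParts d T F) (hT' : IsSumOfParts e T' G) :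
    IsSumOfParts (d + e) (T * T')
      fun r => ∑ x ∈ Finset.HasAntidiagonal.antidiagonal r, F x.1 * G x.2 where
  mem_diffOp r := Submodule.sum_mem _ fun x hx => by
    rw [Finset.HasAntidiagonal.mem_antidiagonal] at hx
    rw [← hx]
    exact comp_mem_diffOp (hT.mem_diffOp x.1) (hT'.mem_diffOp x.2)
  mem_symPow {m r s} hs hr := by
    rw [LinearMap.sum_apply]
    refine Submodule.sum_mem _ fun x hx => ?_
    rw [Finset.HasAntidiagonal.mem_antidiagonal] at hx
    rw [Module.End.mul_apply]
    rcases le_or_gt x.2 (m + e) with h | h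
    · have := hT.mem_symPow (p := x.1) (hT'.mem_symPow hs h) (by omega)
      rwa [show m + e - x.2 + d - x.1 = m + (d + e) - r by omega] at this
    · rw [hT'.eq_zero hs h, map_zero]
      exact zero_mem _
  eq_zero {m r s} hs hr := by
    rw [LinearMap.sum_apply]
    refine Finset.sum_eq_zero fun x hx => ?_
    rw [Finset.HasAntidiagonal.mem_antidiagonal] at hx
    rw [Module.End.mul_apply]
    rcases le_or_gt x.2 (m + e) with h | h
    · exact hT.eq_zero (hT'.mem_symPow hs h) (by omega)
    · rw [hT'.eq_zero hs h, map_zero]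
  eq_sum {m s} hs := by
    have h₁ : T (T' s) = ∑ q ∈ Finset.range (m + e + 1),
        ∑ p ∈ Finset.range (m + e - q + d + 1), F p (G q s) := by
      rw [hT'.eq_sum hs, map_sum]
      refine Finset.sum_congr rfl fun q hq => ?_
      exact hT.eq_sum (hT'.mem_symPow hs (by simpa [Nat.lt_succ_iff] using hq))
    rw [Module.End.mul_apply, h₁]
    simp only [LinearMap.sum_apply, Module.End.mul_apply]
    rw [Finset.sum_sigma', Finset.sum_sigma']
    -- Regroup by total loss of degree `p + q`. The indices missed have `q > m + e`, where `G q`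
    -- already kills `s`.
    refine Finset.sum_of_injOn (fun x => ⟨x.2 + x.1, x.2, x.1⟩) ?_ ?_ ?_ ?_
    · rintro ⟨q, p⟩ _ ⟨q', p'⟩ _ h
      simp only [Sigma.mk.injEq] at h
      obtain ⟨_, h⟩ := h
      have := eq_of_heq h
      simp_all
    · rintro ⟨q, p⟩ h
      simp at h ⊢
      omega
    · rintro ⟨r, p, q⟩ h h'
      simp only [Finset.mem_sigma, Finset.mem_range,
        Finset.HasAntidiagonal.mem_antidiagonal] at h
      obtain ⟨hr, rfl⟩ := h
      have hq : m + e < q := by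
        by_contra hq
        refine h' ⟨⟨q, p⟩, ?_, rfl⟩
        simp
        omega
      simp [hT'.eq_zero hs hq]
    · rintro ⟨q, p⟩ _
      rfl

theorem IsSumOfParts.exists_pow {T : Module.End k S} {F : ℕ → Module.End k S}
    (hT : IsSumOfParts 1 T F) (n : ℕ) : ∃ G, IsSumOfParts n (T ^ n) G := by
  induction n with
  | zero => exact ⟨_, pow_zero T ▸ IsSumOfParts.one⟩
  | succ n ih =>
    obtain ⟨G, hG⟩ := ih
    exact ⟨_, pow_succ T n ▸ hG.mul hT⟩

theorem IsSumOfParts.proj_eq {d : ℕ} {T : S →ₗ[k] S} {F : ℕ → S →ₗ[k] S}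
    (hT : IsSumOfParts d T F) {m : ℕ} {s : S} (hs : s ∈ symPow k V m) (p : ℕ) :
    (if p ≤ m + d then GradedAlgebra.proj (symPow k V) (m + d - p) (T s) else 0) = F p s := by
  split_ifs with hp
  · rw [hT.eq_sum hs, map_sum, Finset.sum_eq_single p]
    · rw [GradedAlgebra.proj_apply, DirectSum.decompose_of_mem_same _ (hT.mem_symPow hs hp)]
    · intro q hq hqp
      have hq' : q ≤ m + d := by simpa [Nat.lt_succ_iff] using hq
      rw [GradedAlgebra.proj_apply,
        DirectSum.decompose_of_mem_ne _ (hT.mem_symPow hs hq') (by omega)]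
    · intro h
      exact absurd (Finset.mem_range.2 (by omega)) h
  · exact (hT.eq_zero hs (by omega)).symm

end HomogeneousParts

/-! ### The star product and its components -/

section StarProduct

variable {k g : Type*} [Field k] [CharZero k] [LieRing g] [LieAlgebra k g]

local notation "S" => SymmetricAlgebra k g
local notation "ιS" => SymmetricAlgebra.ι k g
local notation "U" => UniversalEnvelopingAlgebra k g
local notation "ιU" => UniversalEnvelopingAlgebra.ι k (L := g)

theorem convOp_scaleEval_single_pow (c : k) (p : ℕ) (x y : g) (m : ℕ) :
    convOp (scaleEval (Pi.single p c) x) (ιS y ^ m) =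
      (m.choose p * c : k) • (ιS ((LieAlgebra.ad k g y ^ p) x) * ιS y ^ (m - p)) := by
  rw [convOp_pow]
  rcases le_or_gt p m with hp | hp
  · rw [Finset.sum_eq_single (p, m - p)]
    · rw [scaleEval_pow, Pi.single_eq_same, map_smul, smul_mul_assoc, smul_smul]
    · rintro ⟨i, j⟩ hij h
      rw [Finset.HasAntidiagonal.mem_antidiagonal] at hij
      have hi : i ≠ p := by
        rintro rfl
        exact h (by rw [← hij]; simp)
      simp only [scaleEval_pow, Pi.single_eq_of_ne hi]
      simp
    · intro h
      exact absurd (Finset.HasAntidiagonal.mem_antidiagonal.2 (Nat.add_sub_cancel' hp)) h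
  · rw [Nat.choose_eq_zero_of_lt hp, Nat.cast_zero, zero_mul, zero_smul]
    refine Finset.sum_eq_zero fun x hx => ?_
    rw [Finset.HasAntidiagonal.mem_antidiagonal] at hx
    rw [scaleEval_pow, Pi.single_eq_of_ne (show x.1 ≠ p by omega)]
    simp

theorem isSumOfParts_convOp_scaleEval (c : ℕ → k) (x : g) :
    IsSumOfParts 1 (convOp (scaleEval c x))
      fun p => convOp (scaleEval (Pi.single p (c p)) x) where
  mem_diffOp p := convOp_mem_diffOp fun n hn s hs => by
    rw [scaleEval, LinearMap.comp_apply, gradedScale_of_mem _ hs,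
      Pi.single_eq_of_ne (show n ≠ p by omega), zero_smul, map_zero]
  mem_symPow {m p s} hs hp := by
    rw [symPow_eq_span] at hs
    induction hs using Submodule.span_induction with
    | zero => simp
    | add s t _ _ hs ht =>
      rw [map_add]
      exact add_mem hs ht
    | smul r s _ hs =>
      rw [map_smul]
      exact Submodule.smul_mem _ r hs
    | mem s hs =>
      obtain ⟨y, rfl⟩ := hs
      simp only [convOp_scaleEval_single_pow]
      rcases le_or_gt p m with hpm | hpm
      · refine Submodule.smul_mem _ _ ?_
        rw [show m + 1 - p = 1 + (m - p) by omega]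
        exact SetLike.mul_mem_graded (ι_mem_symPow k g _) (ι_pow_mem_symPow _ y)
      · simp [Nat.choose_eq_zero_of_lt hpm]
  eq_zero {m p s} hs hp := by
    rw [symPow_eq_span] at hs
    induction hs using Submodule.span_induction with
    | zero => simp
    | add s t _ _ hs ht => rw [map_add, hs, ht, add_zero]
    | smul r s _ hs => rw [map_smul, hs, smul_zero]
    | mem s hs =>
      obtain ⟨y, rfl⟩ := hs
      simp [convOp_scaleEval_single_pow, Nat.choose_eq_zero_of_lt (show m < p by omega)]
  eq_sum {m s} hs := by
    rw [symPow_eq_span] at hs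
    induction hs using Submodule.span_induction with
    | zero => simp
    | add s t _ _ hs ht => simp only [map_add, Finset.sum_add_distrib, hs, ht]
    | smul r s _ hs => simp only [map_smul, ← Finset.smul_sum, hs]
    | mem s hs =>
      obtain ⟨y, rfl⟩ := hs
      simp only [convOp_scaleEval_single_pow]
      -- The range also contains `p = m + 1`, where the binomial coefficient is zero.
      rw [Finset.sum_range_succ, Nat.choose_eq_zero_of_lt (Nat.lt_succ_self m), convOp_pow,
        Finset.Nat.sum_antidiagonal_eq_sum_range_succ_mk]
      simp [scaleEval_pow, smul_smul]

/-- The operator that corresponds to the right multiplication by `x` in the enveloping algebra. -/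
def rightOp (x : g) : Module.End k S :=
  convOp (scaleEval ((fun n => bernoulliCoeff k n * n.factorial) + Pi.single 1 1) x)

/-- `unsymmetrize` intertwines the two actions and, by surjectivity of symmetrization, is its
two-sided inverse. -/
theorem symmetrization_leftRep (x : g) (s : S) :
    symmetrization k g (leftRep k g x s) = ιU x * symmetrization k g s := by
  obtain ⟨t, ht⟩ := symmetrization_surjective k g (ιU x * symmetrization k g s)
  have h := unsymmetrize_ι_mul x (symmetrization k g s)
  rw [← ht, unsymmetrize_symmetrization, unsymmetrize_symmetrization] at h
  rw [← h, ht]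

/-- Telescoping in `y^i x y^(n+1-i)`. -/
theorem sum_pow_mul_commutator_mul_pow {A : Type*} [Ring A] (x y : A) (n : ℕ) :
    ∑ i ∈ Finset.range (n + 1), y ^ i * (y * x - x * y) * y ^ (n - i) =
      y ^ (n + 1) * x - x * y ^ (n + 1) := by
  have h := Finset.sum_range_sub (fun i => y ^ i * x * y ^ (n + 1 - i)) (n + 1)
  simp only [Nat.sub_self, pow_zero, mul_one, one_mul, Nat.sub_zero] at h
  rw [← h]
  refine Finset.sum_congr rfl fun i hi => ?_
  rw [Finset.mem_range] at hi
  rw [Nat.add_sub_add_right, show n + 1 - i = n - i + 1 by omega, pow_succ y i,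
    pow_succ' y (n - i)]
  noncomm_ring

theorem symmetrization_rightOp (x : g) (s : S) :
    symmetrization k g (rightOp x s) = symmetrization k g s * ιU x := by
  -- Adding `1` to `B_1` replaces `t/(e^t - 1)` by `t/(e^t - 1) + t = t/(1 - e^(-t))`. The extra
  -- operator sends `y^m` to `m [y, x] y^(m-1)`, and its symmetrization is the commutator `y^m x - x
  -- y^m`.
  have hadd : (rightOp x : Module.End k S) =
      leftRep k g x + convOp (scaleEval (Pi.single 1 1) x) := by
    rw [rightOp, leftRep_apply, ← convOp_add]
    congr 1
    refine linearMap_ext_pow fun n y => ?_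
    rw [LinearMap.add_apply, bernoulliEval, scaleEval_pow, scaleEval_pow, scaleEval_pow,
      Pi.add_apply, add_smul]
  suffices h : symmetrization k g ∘ₗ rightOp x =
      LinearMap.mulRight k (ιU x) ∘ₗ symmetrization k g from LinearMap.congr_fun h s
  refine linearMap_ext_pow fun n y => ?_
  rw [LinearMap.comp_apply, LinearMap.comp_apply, hadd, LinearMap.add_apply, map_add,
    symmetrization_leftRep, convOp_scaleEval_single_pow, symmetrization_pow,
    LinearMap.mulRight_apply]
  cases n with
  | zero => simp
  | succ n =>
    have h0 : (n + 1 : k) ≠ 0 := by exact_mod_cast n.succ_ne_zero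
    rw [map_smul, Nat.add_sub_cancel, symmetrization_ι_mul_pow, smul_smul, Nat.choose_one_right,
      Nat.cast_succ, mul_one, mul_inv_cancel₀ h0, one_smul, pow_one, LieAlgebra.ad_apply,
      LieHom.map_lie, LieRing.of_associative_ring_bracket, sum_pow_mul_commutator_mul_pow]
    abel

theorem starProduct_pow_left (x : g) (n : ℕ) (s : S) :
    starProduct k g (ιS x ^ n) s = (leftRep k g x ^ n) s := by
  rw [starProduct_apply, symmetrizationInv_eq, symmetrization_pow, unsymmetrize_ι_pow_mul,
    unsymmetrize_symmetrization]

theorem starProduct_pow_right (x : g) (n : ℕ) (s : S) :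
    starProduct k g s (ιS x ^ n) = (rightOp x ^ n) s := by
  rw [starProduct_apply, symmetrizationInv_eq, symmetrization_pow]
  suffices h : symmetrization k g s * ιU x ^ n = symmetrization k g ((rightOp x ^ n) s) by
    rw [h, unsymmetrize_symmetrization]
  induction n with
  | zero => simp
  | succ n ih => rw [pow_succ, ← mul_assoc, ih, pow_succ', Module.End.mul_apply,
      symmetrization_rightOp]

theorem starComponent_mem_diffOp (p : ℕ) (a : S) :
    starComponent k g p a ∈ diffOp k S (p + 1) := by
  have ha : a ∈ Submodule.span k (Set.range fun x : ℕ × g => ιS x.2 ^ x.1) :=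
    span_pow k g ▸ Submodule.mem_top
  induction ha using Submodule.span_induction with
  | zero => simp
  | add a b _ _ ha hb =>
    rw [map_add]
    exact add_mem ha hb
  | smul r a _ ha =>
    rw [map_smul]
    exact Submodule.smul_mem _ r ha
  | mem a ha =>
    obtain ⟨⟨n, x⟩, rfl⟩ := ha
    -- The operator has parts starting at degree shift `1`, so its `n`-th power has parts `G p` of
    -- degree shift `n - p`; comparing homogeneous components on each `y^m` identifies `G p` with
    -- `B_p(x^n, ·)`.
    obtain ⟨G, hG⟩ := IsSumOfParts.exists_pow (T := leftRep k g x)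
      (isSumOfParts_convOp_scaleEval _ x) n
    convert hG.mem_diffOp p
    refine linearMap_ext_pow fun m y => ?_
    rw [starComponent, component_apply _ _ (ι_pow_mem_symPow n x) (ι_pow_mem_symPow m y),
      starProduct_pow_left, add_comm n m]
    exact hG.proj_eq (ι_pow_mem_symPow m y) p

theorem starComponent_flip_mem_diffOp (p : ℕ) (a : S) :
    (starComponent k g p).flip a ∈ diffOp k S (p + 1) := by
  have ha : a ∈ Submodule.span k (Set.range fun x : ℕ × g => ιS x.2 ^ x.1) :=
    span_pow k g ▸ Submodule.mem_top
  induction ha using Submodule.span_induction with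
  | zero => simp
  | add a b _ _ ha hb =>
    rw [map_add]
    exact add_mem ha hb
  | smul r a _ ha =>
    rw [map_smul]
    exact Submodule.smul_mem _ r ha
  | mem a ha =>
    obtain ⟨⟨n, x⟩, rfl⟩ := ha
    obtain ⟨G, hG⟩ := IsSumOfParts.exists_pow (T := rightOp (k := k) x)
      (isSumOfParts_convOp_scaleEval _ x) n
    convert hG.mem_diffOp p
    refine linearMap_ext_pow fun m y => ?_
    rw [LinearMap.flip_apply, starComponent,
      component_apply _ _ (ι_pow_mem_symPow m y) (ι_pow_mem_symPow n x), starProduct_pow_right]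
    exact hG.proj_eq (ι_pow_mem_symPow m y) p

end StarProduct

end PBW

end

theorem theorem2p2 (k g : Type*) [Field k] [CharZero k] [LieRing g] [LieAlgebra k g] :
    Function.Bijective (PBW.symmetrization k g) ∧
    ∀ p : ℕ, 1 ≤ p →
      (∀ a : SymmetricAlgebra k g,
        PBW.IsDifferentialOperator p (PBW.starComponent k g p a) ∧
        PBW.IsDifferentialOperator p ((PBW.starComponent k g p).flip a)) ∧
      PBW.IsBidifferentialOperator p (PBW.starComponent k g p) := by
  have hl (p : ℕ) (a : SymmetricAlgebra k g) :=
    PBW.isDifferentialOperator_of_mem_diffOp (PBW.starComponent_mem_diffOp p a)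
  have hr (p : ℕ) (a : SymmetricAlgebra k g) :=
    PBW.isDifferentialOperator_of_mem_diffOp (PBW.starComponent_flip_mem_diffOp p a)
  exact ⟨PBW.symmetrization_bijective k g, fun p _ =>
    ⟨fun a => ⟨hl p a, hr p a⟩, hl p, hr p⟩⟩
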